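/- Let $d\ge 1$ and $n\ge 0$ be integers. A Dyck path of semi-length $n$ is a lattice path that starts at the origin, consists of $n$ steps $U=(1,1)$ and $n$ steps $D=(1,-1)$, and never goes below the $x$-axis. A valley of such a path is a step $D$ immediately followed by a step $U$; its height is the $y$-coordinate of the point between these two steps. Let $\nu_1,\dots,\nu_m$ be the heights of the valleys, from left to right. The path is a $d$-Dyck path if $\nu_{i+1}-\nu_i\ge d$ for all $1\le i<m$ (in particular, if it has at most one valley). A partition of $[n]=\{1,\dots,n\}$ is written $B_1/B_2/\cdots/B_k$ with its (non-empty) blocks listed in increasing order of their minimal elements. Join by an arc any two numerically consecutive elements of the same block; the partition is non-crossing if there are no arcs $\{a,b\}$ and $\{a',b'\}$ with $a<a'<b<b'$. Let $\mathrm{NC}_d(n)$ be the set of non-crossing partitions $B_1/B_2/\cdots/B_k$ of $[n]$ such that, for each $1<i<k$, the block $B_i$ has at least $d$ elements larger than $\max(B_{i+1})$. Then the set of $d$-Dyck paths of semi-length $n$ and the set $\mathrm{NC}_d(n)$ are in bijection. Furthermore, if $(n,d)\ne(0,1)$, then $$|\mathrm{NC}_d(n)|=\sum_{k=0}^{\left\lfloor\frac{n+d-2}{d}\right\rfloor}\binom{n-(d-1)(k-1)}{2k}.$$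 -/

import Mathlib

/-! Restricted `d`-Dyck paths and restricted non-crossing partitions.

Dyck paths are Mathlib's `DyckWord`s: words in the steps `U = (1, 1)` and `D = (1, -1)`. -/

/-- The heights (`y`-coordinates) of the valley vertices, from left to right, of the lattice path
that starts at height `h` and follows the given steps. A valley is an occurrence of `D` immediately
followed by `U`, and its vertex is the point between these two steps. -/
def valleyHeightsFrom (h : ℤ) : List DyckStep → List ℤ
  | [] => []
  | DyckStep.U :: w => valleyHeightsFrom (h + 1) w
  | DyckStep.D :: w =>
      if w.head? = some DyckStep.U then (h - 1) :: valleyHeightsFrom (h - 1) w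
      else valleyHeightsFrom (h - 1) w

/-- The vector of valley heights `(ν₁, …, νₖ)` of a Dyck path. -/
def valleyVector (p : DyckWord) : List ℤ :=
  valleyHeightsFrom 0 p.toList

/-- A Dyck path is a (restricted) `d`-Dyck path if `ν_{i+1} - ν_i ≥ d` for any two consecutive
entries of its valley vector; this holds vacuously if there is at most one valley. -/
def IsRestrictedDyck (d : ℤ) (p : DyckWord) : Prop :=
  (valleyVector p).IsChain (fun a b => d ≤ b - a)

/-- The set of `d`-Dyck paths of semi-length `n` (that is, of length `2 n`). -/
def restrictedDyckPaths (d : ℤ) (n : ℕ) : Set DyckWord :=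
  {p | p.semilength = n ∧ IsRestrictedDyck d p}

/-- In the graph representation of a set partition, `a < b` are joined by an arc if they are
numerically consecutive elements of one of its blocks. -/
def IsArc {s : Finset ℕ} (π : Finpartition s) (a b : ℕ) : Prop :=
  ∃ B ∈ π.parts, a ∈ B ∧ b ∈ B ∧ a < b ∧ ∀ c ∈ B, ¬ (a < c ∧ c < b)

/-- A set partition is non-crossing if no two arcs of its graph representation cross. -/
def IsNonCrossing {s : Finset ℕ} (π : Finpartition s) : Prop :=
  ∀ a b a' b' : ℕ, IsArc π a b → IsArc π a' b' → ¬ (a < a' ∧ a' < b ∧ b < b')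

/-- When the blocks are listed by increasing minimum as `B₁/B₂/⋯/Bₖ`, the block `C` comes
immediately after the block `B`: `B = B_i` and `C = B_{i+1}` for some `i`. -/
def IsNextBlock {s : Finset ℕ} (π : Finpartition s) (B C : Finset ℕ) : Prop :=
  B ∈ π.parts ∧ C ∈ π.parts ∧ B.min < C.min ∧
    ∀ E ∈ π.parts, ¬ (B.min < E.min ∧ E.min < C.min)

/-- The set `NC_d(n)` of the non-crossing partitions `B₁/B₂/⋯/Bₖ` of `{1, …, n}`, with blocks listed
by increasing minimum, such that for all `1 < i < k` the block `B_i` has at least `d` elements that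
are larger than `max B_{i+1}`. The block `B_i` has `1 < i` exactly if some block precedes it. -/
def restrictedNC (d n : ℕ) : Set (Finpartition (Finset.Icc 1 n)) :=
  {π | IsNonCrossing π ∧
    ∀ B C : Finset ℕ, IsNextBlock π B C → (∃ A ∈ π.parts, A.min < B.min) →
      d ≤ (B.filter (fun x : ℕ => C.max < (x : WithBot ℕ))).card}

/-! For `0 < n` both sets are encoded by the same lists of pairs `(a, b)`. In a Dyck path every
valley is preceded by a run of `a + b` up-steps and a run of `a` down-steps, so that valley heights
rise by `b` from one valley to the next; the path is `d`-restricted exactly if `d ≤ b` for every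
pair but the first. The last peak is determined by what remains, and it exists because the entries
sum to less than `n`.

In a partition in `NC_d(n)` with `0 < d`, each block other than the first and the last reaches
beyond all later blocks. Hence the second block contains both the least and the greatest element
outside the first block, and non-crossing leaves the first block nothing in between: it consists of
the first `a` and the last `b` elements of the interval. Peeling it off leaves a partition of a
smaller interval whose own first block now needs `d ≤ b`; the last block is a whole interval. This
is `IsNestedFamily.exists_code`. The parameter `e` is the bound for the leading pair: 0 at the
outset, `d` after one peeling.

A code with `k` pairs is a `2k`-tuple with prescribed lower bounds and bounded sum, so stars and
bars gives the binomial coefficients. -/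

/-! ### Codes and their number. -/

/-- Lists of pairs `(a, b)` with `1 ≤ a`, with `e ≤ b` for the first pair and `d ≤ b` for all
later ones. -/
def ValidCode (d : ℕ) : ℕ → List (ℕ × ℕ) → Prop
  | _, [] => True
  | e, p :: L => 1 ≤ p.1 ∧ e ≤ p.2 ∧ ValidCode d d L

/-- The sum of all entries. -/
def codeSum : List (ℕ × ℕ) → ℕ
  | [] => 0
  | p :: L => p.1 + p.2 + codeSum L

/-- The codes that describe both `d`-Dyck paths of semi-length `n` and elements of `NC_d(n)`
for `0 < n`. -/
def codes (d e n : ℕ) : Set (List (ℕ × ℕ)) :=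
  {L | ValidCode d e L ∧ codeSum L < n}

/-- The codes of a given length. -/
def codesOfLength (d : ℕ) : ℕ → ℕ → ℕ → Finset (List (ℕ × ℕ))
  | _, 0, n => if 0 < n then {[]} else ∅
  | e, k + 1, n => (Finset.Ico 1 n ×ˢ Finset.Ico e n).biUnion fun p =>
      (codesOfLength d d k (n - p.1 - p.2)).image (List.cons p)

theorem mem_codesOfLength {d : ℕ} : ∀ {k e n : ℕ} {L : List (ℕ × ℕ)},
    L ∈ codesOfLength d e k n ↔ L.length = k ∧ L ∈ codes d e n
  | 0, e, n, [] => by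
      by_cases h : 0 < n <;> simp [codesOfLength, codes, ValidCode, codeSum, h]
  | 0, e, n, p :: L => by
      by_cases h : 0 < n <;> simp [codesOfLength, h]
  | k + 1, e, n, [] => by simp [codesOfLength]
  | k + 1, e, n, p :: L => by
      have ih := @mem_codesOfLength d k d (n - p.1 - p.2) L
      simp only [codes, Set.mem_ofPred_eq] at ih
      simp only [codesOfLength, Finset.mem_biUnion, Finset.mem_product, Finset.mem_Ico,
        Finset.mem_image, List.cons.injEq, codes, Set.mem_ofPred_eq, List.length_cons, ValidCode,
        codeSum, Nat.add_right_cancel_iff]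
      constructor
      · rintro ⟨q, ⟨⟨h1, h2⟩, h3, h4⟩, M, hM, rfl, rfl⟩
        obtain ⟨h5, h6, h7⟩ := ih.1 hM
        exact ⟨h5, ⟨h1, h3, h6⟩, by omega⟩
      · rintro ⟨h1, ⟨h2, h3, h4⟩, h5⟩
        exact ⟨p, ⟨⟨h2, by omega⟩, h3, by omega⟩, L, ih.2 ⟨h1, h4, by omega⟩, rfl, rfl⟩

theorem card_codesOfLength_succ (d e k n : ℕ) :
    (codesOfLength d e (k + 1) n).card =
      ∑ a ∈ Finset.Ico 1 n, ∑ b ∈ Finset.Ico e n, (codesOfLength d d k (n - a - b)).card := by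
  rw [codesOfLength, Finset.card_biUnion, Finset.sum_product]
  · refine Finset.sum_congr rfl fun a _ => Finset.sum_congr rfl fun b _ => ?_
    exact Finset.card_image_of_injective _ (List.cons_injective)
  · intro p _ q _ hpq
    rw [Function.onFun, Finset.disjoint_left]
    intro L hL hL'
    obtain ⟨M, -, rfl⟩ := Finset.mem_image.1 hL
    obtain ⟨M', -, h⟩ := Finset.mem_image.1 hL'
    exact hpq (List.cons.inj h).1.symm

/-- The number of `j`-tuples of naturals with given lower bounds of total `c` and with sum less
than `m`. -/
def boundedTuples (j c m : ℕ) : ℕ :=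
  if m ≤ c then 0 else (m - 1 - c + j).choose j

/-- This is the hockey-stick identity, read in reverse order: the sum runs over one new entry `b`
with lower bound `e`, and the terms with `m ≤ b + c` vanish. -/
theorem sum_boundedTuples (j c e m n : ℕ) (hmn : m ≤ n) :
    ∑ b ∈ Finset.Ico e n, boundedTuples j c (m - b) = boundedTuples (j + 1) (c + e) m := by
  rw [Finset.sum_Ico_eq_sum_range]
  by_cases h : m ≤ c + e
  · rw [boundedTuples, if_pos h]
    refine Finset.sum_eq_zero fun i _ => ?_
    rw [boundedTuples, if_pos (by omega)]
  · obtain ⟨N, rfl⟩ : ∃ N, m = c + e + 1 + N := ⟨m - (c + e + 1), by omega⟩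
    have hsub : Finset.range (N + 1) ⊆ Finset.range (n - e) := by
      intro i; simp only [Finset.mem_range]; omega
    rw [← Finset.sum_subset hsub, boundedTuples, if_neg h]
    · rw [show c + e + 1 + N - 1 - (c + e) + (j + 1) = N + j + 1 by omega,
        ← Nat.sum_range_add_choose, ← Finset.sum_range_reflect]
      refine Finset.sum_congr rfl fun i hi => ?_
      rw [Finset.mem_range] at hi
      rw [boundedTuples, if_neg (by omega)]
      congr 1
      omega
    · intro i _ hi
      rw [Finset.mem_range] at hi
      rw [boundedTuples, if_pos (by omega)]

theorem card_codesOfLength_self (d k n : ℕ) :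
    (codesOfLength d d k n).card = boundedTuples (2 * k) (k * (d + 1)) n := by
  induction k generalizing n with
  | zero =>
    rcases Nat.eq_zero_or_pos n with rfl | h
    · simp [codesOfLength, boundedTuples]
    · simp [codesOfLength, boundedTuples, h, h.ne']
  | succ k ih =>
    simp_rw [card_codesOfLength_succ, ih]
    rw [Finset.sum_congr rfl fun a _ => sum_boundedTuples (2 * k) _ d (n - a) n (Nat.sub_le _ _),
      sum_boundedTuples _ _ _ _ _ le_rfl]
    congr 1
    ring

theorem card_codesOfLength_zero_succ (d k n : ℕ) :
    (codesOfLength d 0 (k + 1) n).card = boundedTuples (2 * (k + 1)) (k * (d + 1) + 1) n := by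
  simp_rw [card_codesOfLength_succ, card_codesOfLength_self]
  rw [Finset.sum_congr rfl fun a _ => sum_boundedTuples (2 * k) _ 0 (n - a) n (Nat.sub_le _ _),
    sum_boundedTuples _ _ _ _ _ le_rfl]
  rfl

/-- For `k ≥ 1` the lower bounds add up to `(k - 1)(d + 1) + 1`, and the upper index simplifies to
`n - (d - 1)(k - 1)`. If the bounds leave no room below `n`, this index is less than `2k`, so the
binomial coefficient vanishes as well. -/
theorem card_codesOfLength_zero {d n : ℕ} (hd : 0 < d) (hn : 0 < n) (k : ℕ) :
    (codesOfLength d 0 k n).card =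
      ((n : ℤ) - ((d : ℤ) - 1) * ((k : ℤ) - 1)).toNat.choose (2 * k) := by
  cases k with
  | zero => simp [codesOfLength, hn]
  | succ k =>
    rw [card_codesOfLength_zero_succ, boundedTuples]
    obtain ⟨d, rfl⟩ : ∃ d', d = d' + 1 := ⟨d - 1, by omega⟩
    push_cast
    rw [show (n : ℤ) - ((d : ℤ) + 1 - 1) * ((k : ℤ) + 1 - 1) = n - (k * d : ℕ) by
        push_cast; ring, show k * (d + 1 + 1) = k * d + 2 * k by ring]
    generalize k * d = x
    split_ifs with h
    · rw [Nat.choose_eq_zero_of_lt]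
      omega
    · congr 1
      omega

theorem length_mul_le_codeSum {d : ℕ} {L : List (ℕ × ℕ)} (hL : ValidCode d d L) :
    L.length * (d + 1) ≤ codeSum L := by
  induction L with
  | nil => simp
  | cons p L ih =>
    have h1 := ih hL.2.2
    have h2 := hL.1
    have h3 := hL.2.1
    rw [List.length_cons, add_mul, codeSum]
    omega

theorem ncard_codes {d n : ℕ} (hd : 0 < d) (hn : 0 < n) :
    (codes d 0 n).ncard = ∑ k ∈ Finset.range ((n + d - 2) / d + 1),
      ((n : ℤ) - ((d : ℤ) - 1) * ((k : ℤ) - 1)).toNat.choose (2 * k) := by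
  have hlen : ∀ L ∈ codes d 0 n, L.length < (n + d - 2) / d + 1 := by
    rintro (_ | ⟨p, L⟩) ⟨hL, hs⟩
    · simp
    · have h1 := length_mul_le_codeSum hL.2.2
      have h2 := hL.1
      rw [codeSum] at hs
      -- With `k` pairs the sum is at least `1 + (k - 1)(d + 1)`; being less than `n`, it forces `k
      -- * d ≤ n + d - 2`.
      rw [Nat.lt_succ_iff, Nat.le_div_iff_mul_le hd, List.length_cons, add_mul]
      rw [mul_add] at h1
      omega
  have heq : codes d 0 n =
      ↑((Finset.range ((n + d - 2) / d + 1)).biUnion fun k => codesOfLength d 0 k n) := by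
    ext L
    simp only [Finset.coe_biUnion, Finset.mem_coe, Finset.mem_range, Set.mem_iUnion,
      mem_codesOfLength, exists_prop]
    exact ⟨fun h => ⟨_, hlen L h, rfl, h⟩, fun ⟨_, _, _, h⟩ => h⟩
  rw [heq, Set.ncard_coe_finset, Finset.card_biUnion]
  · exact Finset.sum_congr rfl fun k _ => card_codesOfLength_zero hd hn k
  · intro k _ k' _ hk
    rw [Function.onFun, Finset.disjoint_left]
    intro L h h'
    exact hk ((mem_codesOfLength.1 h).1.symm.trans (mem_codesOfLength.1 h').1)

/-! ### Codes and Dyck paths. -/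

/-- The lattice path that belongs to a code, from height `h` to `0`, with `n` up-steps. -/
def codeWord : ℕ → ℕ → List (ℕ × ℕ) → List DyckStep
  | h, n, [] => List.replicate n DyckStep.U ++ List.replicate (n + h) DyckStep.D
  | h, n, p :: L => List.replicate (p.1 + p.2) DyckStep.U ++ (List.replicate p.1 DyckStep.D ++
      codeWord (h + p.2) (n - p.1 - p.2) L)

/-- The path that starts at height `h` never goes below the `x`-axis. -/
def StaysNonneg (h : ℤ) (w : List DyckStep) : Prop :=
  ∀ i, ((w.take i).count DyckStep.D : ℤ) ≤ h + (w.take i).count DyckStep.U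

theorem staysNonneg_nil {h : ℤ} : StaysNonneg h [] ↔ 0 ≤ h := by
  simp [StaysNonneg]

theorem staysNonneg_cons_U {h : ℤ} {w : List DyckStep} :
    StaysNonneg h (DyckStep.U :: w) ↔ 0 ≤ h ∧ StaysNonneg (h + 1) w := by
  constructor
  · refine fun H => ⟨by simpa using H 0, fun i => ?_⟩
    have := H (i + 1)
    simp only [List.take_succ_cons, List.count_cons_self, ne_eq, reduceCtorEq, not_false_eq_true,
      List.count_cons_of_ne] at this
    push_cast at this
    linarith
  · rintro ⟨h0, H⟩ (_ | i)
    · simpa using h0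
    · have := H i
      simp only [List.take_succ_cons, List.count_cons_self, ne_eq, reduceCtorEq,
        not_false_eq_true, List.count_cons_of_ne]
      push_cast
      linarith

theorem staysNonneg_cons_D {h : ℤ} {w : List DyckStep} :
    StaysNonneg h (DyckStep.D :: w) ↔ 0 ≤ h ∧ StaysNonneg (h - 1) w := by
  constructor
  · refine fun H => ⟨by simpa using H 0, fun i => ?_⟩
    have := H (i + 1)
    simp only [List.take_succ_cons, List.count_cons_self, ne_eq, reduceCtorEq, not_false_eq_true,
      List.count_cons_of_ne] at this
    push_cast at this
    linarith
  · rintro ⟨h0, H⟩ (_ | i)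
    · simpa using h0
    · have := H i
      simp only [List.take_succ_cons, List.count_cons_self, ne_eq, reduceCtorEq,
        not_false_eq_true, List.count_cons_of_ne]
      push_cast
      linarith

theorem StaysNonneg.nonneg {h : ℤ} {w : List DyckStep} (H : StaysNonneg h w) : 0 ≤ h := by
  simpa using H 0

theorem StaysNonneg.replicate_U_append {w : List DyckStep} {u : ℕ} {h : ℤ} (h0 : 0 ≤ h)
    (H : StaysNonneg (h + u) w) : StaysNonneg h (List.replicate u DyckStep.U ++ w) := by
  induction u generalizing h with
  | zero => simpa using H
  | succ u ih =>
    rw [List.replicate_succ, List.cons_append, staysNonneg_cons_U]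
    refine ⟨h0, ih (by linarith) ?_⟩
    rwa [show h + 1 + u = h + (u + 1 : ℕ) by push_cast; ring]

theorem StaysNonneg.replicate_D_append {w : List DyckStep} {u : ℕ} {h : ℤ}
    (H : StaysNonneg (h - u) w) : StaysNonneg h (List.replicate u DyckStep.D ++ w) := by
  induction u generalizing h with
  | zero => simpa using H
  | succ u ih =>
    have h0 := H.nonneg
    push_cast at h0
    rw [List.replicate_succ, List.cons_append, staysNonneg_cons_D]
    refine ⟨by linarith, ih ?_⟩
    rwa [show h - 1 - u = h - (u + 1 : ℕ) by push_cast; ring]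

theorem StaysNonneg.valleyHeightsFrom_nonneg {w : List DyckStep} {h : ℤ} (H : StaysNonneg h w) :
    ∀ v ∈ valleyHeightsFrom h w, 0 ≤ v := by
  induction w generalizing h with
  | nil => simp [valleyHeightsFrom]
  | cons x w ih =>
    cases x with
    | U => exact ih (staysNonneg_cons_U.1 H).2
    | D =>
      have H' := (staysNonneg_cons_D.1 H).2
      intro v hv
      rw [valleyHeightsFrom] at hv
      split_ifs at hv
      · rcases List.mem_cons.1 hv with rfl | hv
        · exact H'.nonneg
        · exact ih H' v hv
      · exact ih H' v hv

theorem valleyHeightsFrom_replicate_U_append (u : ℕ) (h : ℤ) (w : List DyckStep) :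
    valleyHeightsFrom h (List.replicate u DyckStep.U ++ w) = valleyHeightsFrom (h + u) w := by
  induction u generalizing h with
  | zero => simp
  | succ u ih =>
    rw [List.replicate_succ, List.cons_append, valleyHeightsFrom, ih]
    congr 1
    push_cast
    ring

theorem valleyHeightsFrom_replicate_D (u : ℕ) (h : ℤ) :
    valleyHeightsFrom h (List.replicate u DyckStep.D) = [] := by
  induction u generalizing h with
  | zero => rfl
  | succ u ih =>
    rw [List.replicate_succ, valleyHeightsFrom, ih, if_neg]
    cases u <;> simp [List.replicate_succ]

theorem valleyHeightsFrom_replicate_D_append {u : ℕ} (hu : 1 ≤ u) (h : ℤ) {w : List DyckStep}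
    (hw : w.head? = some DyckStep.U) :
    valleyHeightsFrom h (List.replicate u DyckStep.D ++ w) =
      (h - u) :: valleyHeightsFrom (h - u) w := by
  induction u, hu using Nat.le_induction generalizing h with
  | base => simp [valleyHeightsFrom, hw]
  | succ u hu ih =>
    rw [List.replicate_succ, List.cons_append, valleyHeightsFrom, ih, if_neg,
      show h - 1 - u = h - (u + 1 : ℕ) by push_cast; ring]
    obtain ⟨u, rfl⟩ : ∃ v, u = v + 1 := ⟨u - 1, by omega⟩
    simp [List.replicate_succ]

/-- The strict bound `codeSum L < n` guarantees a final peak, so every descent that a pair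
contributes does end in a valley. -/
theorem head?_codeWord {d e n : ℕ} (h : ℕ) {L : List (ℕ × ℕ)} (hL : L ∈ codes d e n) :
    (codeWord h n L).head? = some DyckStep.U := by
  cases L with
  | nil =>
    obtain ⟨m, rfl⟩ : ∃ m, n = m + 1 := ⟨n - 1, by have := hL.2; omega⟩
    simp [codeWord, List.replicate_succ]
  | cons p L =>
    obtain ⟨m, hm⟩ : ∃ m, p.1 + p.2 = m + 1 := ⟨p.1 + p.2 - 1, by have := hL.1.1; omega⟩
    simp [codeWord, hm, List.replicate_succ]

theorem codes_cons {d e n : ℕ} {p : ℕ × ℕ} {L : List (ℕ × ℕ)} :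
    p :: L ∈ codes d e n ↔
      1 ≤ p.1 ∧ e ≤ p.2 ∧ p.1 + p.2 < n ∧ L ∈ codes d d (n - p.1 - p.2) := by
  simp only [codes, Set.mem_ofPred_eq, ValidCode, codeSum]
  constructor
  · rintro ⟨⟨h1, h2, h3⟩, h4⟩
    exact ⟨h1, h2, by omega, h3, by omega⟩
  · rintro ⟨h1, h2, h3, h4, h5⟩
    exact ⟨⟨h1, h2, h4⟩, by omega⟩

/-- The lattice paths from height `h` to height `0` with `n` up-steps, starting with an up-step,
whose valleys are `d` apart, the first one at height at least `h + e`. -/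
structure IsCodePath (d e h n : ℕ) (w : List DyckStep) : Prop where
  count_U : w.count DyckStep.U = n
  count_D : w.count DyckStep.D = n + h
  head : w.head? = some DyckStep.U
  chain : (((h : ℤ) + e - d) :: valleyHeightsFrom h w).IsChain fun a b => (d : ℤ) ≤ b - a

theorem staysNonneg_codeWord {d e n : ℕ} (h : ℕ) {L : List (ℕ × ℕ)} (hL : L ∈ codes d e n) :
    StaysNonneg h (codeWord h n L) := by
  induction L generalizing e n h with
  | nil =>
    refine StaysNonneg.replicate_U_append (by positivity) ?_
    rw [← List.append_nil (List.replicate _ _)]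
    refine StaysNonneg.replicate_D_append (staysNonneg_nil.2 ?_)
    push_cast
    linarith
  | cons p L ih =>
    obtain ⟨h1, h2, h3, h4⟩ := codes_cons.1 hL
    refine StaysNonneg.replicate_U_append (by positivity) (StaysNonneg.replicate_D_append ?_)
    have := ih (h + p.2) h4
    rwa [show (h : ℤ) + (p.1 + p.2 : ℕ) - p.1 = (h + p.2 : ℕ) by push_cast; ring]

theorem isCodePath_codeWord {d e n : ℕ} (h : ℕ) {L : List (ℕ × ℕ)} (hL : L ∈ codes d e n) :
    IsCodePath d e h n (codeWord h n L) := by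
  induction L generalizing e n h with
  | nil =>
    refine ⟨?_, ?_, head?_codeWord h hL, ?_⟩
    · simp [codeWord, List.count_replicate]
    · simp [codeWord, List.count_replicate]
    · rw [codeWord, valleyHeightsFrom_replicate_U_append, valleyHeightsFrom_replicate_D]
      simp
  | cons p L ih =>
    obtain ⟨h1, h2, h3, h4⟩ := codes_cons.1 hL
    obtain ⟨i1, i2, i3, i4⟩ := ih (h + p.2) h4
    refine ⟨?_, ?_, head?_codeWord h hL, ?_⟩
    · simp [codeWord, List.count_replicate, i1]
      omega
    · simp [codeWord, List.count_replicate, i2]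
      omega
    · rw [codeWord, valleyHeightsFrom_replicate_U_append,
        valleyHeightsFrom_replicate_D_append h1 _ i3,
        show (h : ℤ) + (p.1 + p.2 : ℕ) - p.1 = (h + p.2 : ℕ) by push_cast; ring,
        List.isChain_cons_cons]
      -- For `e = d` the auxiliary head of the chain is the starting height itself, here the height
      -- of the valley just passed.
      rw [add_sub_cancel_right] at i4
      refine ⟨?_, i4⟩
      push_cast
      have : (e : ℤ) ≤ p.2 := by exact_mod_cast h2
      linarith

theorem exists_replicate_append {α : Type*} (x : α) (w : List α) :
    ∃ u r, w = List.replicate u x ++ r ∧ r.head? ≠ some x := by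
  induction w with
  | nil => exact ⟨0, [], by simp⟩
  | cons y w ih =>
    by_cases h : y = x
    · obtain ⟨u, r, rfl, hr⟩ := ih
      exact ⟨u + 1, r, by simp [h, List.replicate_succ], hr⟩
    · exact ⟨0, y :: w, by simp [h]⟩

theorem replicate_append_inj {α : Type*} {x : α} {u v : ℕ} {r r' : List α}
    (hr : r.head? ≠ some x) (hr' : r'.head? ≠ some x)
    (h : List.replicate u x ++ r = List.replicate v x ++ r') : u = v ∧ r = r' := by
  induction u generalizing v with
  | zero =>
    cases v with
    | zero => simpa using h
    | succ v =>
      simp only [List.replicate_zero, List.nil_append] at h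
      simp [h, List.replicate_succ] at hr
  | succ u ih =>
    cases v with
    | zero =>
      simp only [List.replicate_zero, List.nil_append] at h
      simp [← h, List.replicate_succ] at hr'
    | succ v =>
      simp only [List.replicate_succ, List.cons_append, List.cons.injEq, true_and] at h
      simpa using ih h

/-- Split off the maximal runs of `u` up-steps and `t` down-steps. If nothing remains, the code is
empty; otherwise the first pair is `(t, u - t)`, and the head of the chain yields `t + e ≤ u`. -/
theorem IsCodePath.exists_codeWord {d e h n : ℕ} {w : List DyckStep}
    (hw : IsCodePath d e h n w) : ∃ L ∈ codes d e n, codeWord h n L = w := by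
  induction hl : w.length using Nat.strong_induction_on generalizing e h n w with
  | _ l ih =>
  obtain ⟨u, w', rfl, hw'⟩ := exists_replicate_append DyckStep.U w
  obtain ⟨t, r, rfl, hr⟩ := exists_replicate_append DyckStep.D w'
  obtain ⟨i1, i2, i3, i4⟩ := hw
  simp only [List.count_append, List.count_replicate, beq_self_eq_true, if_true,
    reduceCtorEq, beq_iff_eq, if_false, zero_add] at i1 i2
  have hu : u ≠ 0 := by
    rintro rfl
    exact hw' (by simpa using i3)
  rcases r with - | ⟨x, r⟩
  · simp only [List.count_nil, add_zero] at i1 i2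
    subst i1 i2
    exact ⟨[], ⟨trivial, Nat.pos_of_ne_zero hu⟩, by simp [codeWord]⟩
  · have hx : x = DyckStep.U := by
      cases x with
      | U => rfl
      | D => simp at hr
    subst hx
    have ht : 1 ≤ t := by
      rcases t with - | t
      · simp at hw'
      · omega
    rw [valleyHeightsFrom_replicate_U_append, valleyHeightsFrom_replicate_D_append ht _ (by simp),
      List.isChain_cons_cons] at i4
    obtain ⟨j1, j2⟩ := i4
    have hut : t + e ≤ u := by omega
    have heq : (h : ℤ) + u - t = (h + (u - t) : ℕ) := by omega
    rw [heq] at j2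
    have hpos : 0 < (DyckStep.U :: r).count DyckStep.U := by simp
    obtain ⟨L, hL, hLr⟩ := ih (DyckStep.U :: r).length
      (by rw [← hl]; simp only [List.length_append, List.length_replicate]; omega)
      (e := d) (h := h + (u - t)) (n := n - u) (w := DyckStep.U :: r)
      ⟨by omega, by omega, by simp, by rwa [add_sub_cancel_right]⟩ rfl
    refine ⟨(t, u - t) :: L, codes_cons.2 ⟨ht, ?_, ?_, ?_⟩, ?_⟩
    · dsimp only; omega
    · dsimp only; omega
    · dsimp only
      rwa [show n - t - (u - t) = n - u by omega]
    · simp only [codeWord]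
      rw [show n - t - (u - t) = n - u by omega, hLr, show t + (u - t) = u by omega]

/-- Only the empty code gives a path without valleys; otherwise the first maximal runs determine the
first pair. -/
theorem codeWord_injOn (d e h n : ℕ) : Set.InjOn (codeWord h n) (codes d e n) := by
  intro L hL L' hL' heq
  induction L generalizing e h n L' with
  | nil =>
    rcases L' with - | ⟨q, L'⟩
    · rfl
    · obtain ⟨k1, k2, k3, k4⟩ := codes_cons.1 hL'
      exfalso
      have := congrArg (valleyHeightsFrom h) heq
      rw [codeWord, codeWord, valleyHeightsFrom_replicate_U_append, valleyHeightsFrom_replicate_D,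
        valleyHeightsFrom_replicate_U_append,
        valleyHeightsFrom_replicate_D_append k1 _ (head?_codeWord _ k4)] at this
      simp at this
  | cons p L ih =>
    obtain ⟨h1, h2, h3, h4⟩ := codes_cons.1 hL
    rcases L' with - | ⟨q, L'⟩
    · exfalso
      have := congrArg (valleyHeightsFrom h) heq
      rw [codeWord, codeWord, valleyHeightsFrom_replicate_U_append,
        valleyHeightsFrom_replicate_U_append, valleyHeightsFrom_replicate_D,
        valleyHeightsFrom_replicate_D_append h1 _ (head?_codeWord _ h4)] at this
      simp at this
    · obtain ⟨k1, k2, k3, k4⟩ := codes_cons.1 hL'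
      have hD : ∀ {t : ℕ} (r : List DyckStep), 1 ≤ t →
          (List.replicate t DyckStep.D ++ r).head? ≠ some DyckStep.U := by
        rintro (_ | t) r ht <;> simp [List.replicate_succ] at ht ⊢
      rw [codeWord, codeWord] at heq
      obtain ⟨e1, e2⟩ := replicate_append_inj (hD _ h1) (hD _ k1) heq
      obtain ⟨e3, e4⟩ := replicate_append_inj (by simp [head?_codeWord _ h4])
        (by simp [head?_codeWord _ k4]) e2
      obtain ⟨a, b⟩ := p
      obtain ⟨a', b'⟩ := q
      dsimp only at *
      obtain rfl := e3
      obtain rfl : b = b' := by omega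
      rw [ih _ _ _ h4 k4 e4]

theorem toList_image_restrictedDyckPaths {d n : ℕ} (hn : 0 < n) :
    DyckWord.toList '' restrictedDyckPaths d n = codeWord 0 n '' codes d 0 n := by
  ext w
  constructor
  · rintro ⟨p, ⟨hp1, hp2⟩, rfl⟩
    have hp3 : StaysNonneg 0 p.toList := fun i => by
      have := p.count_D_le_count_U i
      rw [zero_add]
      exact_mod_cast this
    refine IsCodePath.exists_codeWord ⟨hp1, ?_, ?_, ?_⟩
    · rw [add_zero, ← p.count_U_eq_count_D]; exact hp1
    · have hne : p.toList ≠ [] := by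
        intro h
        rw [DyckWord.semilength, h] at hp1
        simp at hp1
        omega
      generalize p.toList = l at hp3 hne
      rcases l with - | ⟨_ | _, l⟩
      · exact absurd rfl hne
      · rfl
      · have := (staysNonneg_cons_D.1 hp3).2.nonneg
        omega
    -- For `h = e = 0` the head of the chain is `-d`, so it only demands that the first valley be at
    -- height at least 0.
    · have h1 := hp3.valleyHeightsFrom_nonneg
      have h2 : (valleyHeightsFrom 0 p.toList).IsChain _ := hp2
      rw [Nat.cast_zero]
      generalize valleyHeightsFrom 0 p.toList = l at h1 h2
      cases l with
      | nil => simp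
      | cons v l =>
        refine List.isChain_cons_cons.2 ⟨?_, h2⟩
        have := h1 v (by simp)
        simpa using this
  · rintro ⟨L, hL, rfl⟩
    obtain ⟨h1, h2, h3, h4⟩ := isCodePath_codeWord 0 hL
    refine ⟨⟨codeWord 0 n L, by rw [h1, h2, add_zero], fun i => ?_⟩, ⟨h1, ?_⟩, rfl⟩
    · have := staysNonneg_codeWord 0 hL i
      rw [Nat.cast_zero, zero_add] at this
      exact_mod_cast this
    · exact h4.tail

/-! ### Codes and nested families of blocks. -/

/-- The blocks of the partition of `[s, t)` that belongs to a code: a pair `(a, b)` stands for a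
block that consists of the first `a` and the last `b` elements of an interval. -/
def codeBlocks : ℕ → ℕ → List (ℕ × ℕ) → Finset (Finset ℕ)
  | s, t, [] => {Finset.Ico s t}
  | s, t, p :: L => insert (Finset.Ico s (s + p.1) ∪ Finset.Ico (t - p.2) t)
      (codeBlocks (s + p.1) (t - p.2) L)

/-- `P` is the set of blocks of a non-crossing partition of `[s, t)` in which any block `B`
other than the first one has `d` elements larger than each block that starts after `B`, and in
which the first block has `e` elements larger than each other block. -/
structure IsNestedFamily (d e s t : ℕ) (P : Finset (Finset ℕ)) : Prop where
  nonempty : ∀ B ∈ P, B.Nonempty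
  eq_of_mem : ∀ B ∈ P, ∀ C ∈ P, ∀ x ∈ B, x ∈ C → B = C
  cover : ∀ x, (∃ B ∈ P, x ∈ B) ↔ s ≤ x ∧ x < t
  noncrossing : ∀ B ∈ P, ∀ C ∈ P, B ≠ C → ∀ a ∈ B, ∀ a' ∈ C, ∀ b ∈ B, ∀ b' ∈ C,
    a < a' → a' < b → b < b' → False
  first : ∀ B ∈ P, ∀ C ∈ P, s ∈ B → B ≠ C → e ≤ (B.filter fun x => ∀ y ∈ C, y < x).card
  later : ∀ B ∈ P, ∀ C ∈ P, s ∉ B → (∃ x ∈ B, ∀ y ∈ C, x < y) →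
    d ≤ (B.filter fun x => ∀ y ∈ C, y < x).card

theorem IsNestedFamily.mem_Ico {d e s t : ℕ} {P : Finset (Finset ℕ)}
    (h : IsNestedFamily d e s t P) {B : Finset ℕ} (hB : B ∈ P) {x : ℕ} (hx : x ∈ B) :
    s ≤ x ∧ x < t :=
  (h.cover x).1 ⟨B, hB, hx⟩

theorem isNestedFamily_singleton {d e s t : ℕ} (hst : s < t) :
    IsNestedFamily d e s t {Finset.Ico s t} := by
  constructor
  · simpa using hst
  · simp
  · simp
  · intro B hB C hC hne
    rw [Finset.mem_singleton] at hB hC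
    exact absurd (hB.trans hC.symm) hne
  · intro B hB C hC _ hne
    rw [Finset.mem_singleton] at hB hC
    exact absurd (hB.trans hC.symm) hne
  · intro B hB C _ hs
    rw [Finset.mem_singleton] at hB
    subst hB
    simp [hst] at hs

/-- The new block lies outside the interval that the others fill, so it crosses none of them, and
its last `b` elements exceed them all. -/
theorem IsNestedFamily.insert {d e s t a b : ℕ} {P : Finset (Finset ℕ)} (ha : 1 ≤ a) (hb : e ≤ b)
    (hab : s + a < t - b) (h : IsNestedFamily d d (s + a) (t - b) P) :
    IsNestedFamily d e s t (insert (Finset.Ico s (s + a) ∪ Finset.Ico (t - b) t) P) := by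
  set N := Finset.Ico s (s + a) ∪ Finset.Ico (t - b) t with hN
  have memN : ∀ x, x ∈ N ↔ (s ≤ x ∧ x < s + a) ∨ (t - b ≤ x ∧ x < t) := by
    intro x; simp [hN]
  have hP : ∀ B ∈ P, ∀ x ∈ B, s + a ≤ x ∧ x < t - b := fun B hB x hx => h.mem_Ico hB hx
  constructor
  · intro B hB
    rcases Finset.mem_insert.1 hB with rfl | hB
    · exact ⟨s, (memN s).2 (by omega)⟩
    · exact h.nonempty B hB
  · intro B hB C hC x hxB hxC
    rcases Finset.mem_insert.1 hB with rfl | hB <;> rcases Finset.mem_insert.1 hC with rfl | hC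
    · rfl
    · have := (memN x).1 hxB
      have := hP C hC x hxC
      omega
    · have := (memN x).1 hxC
      have := hP B hB x hxB
      omega
    · exact h.eq_of_mem B hB C hC x hxB hxC
  · intro x
    rw [Finset.exists_mem_insert, h.cover, memN]
    omega
  · intro B hB C hC hne x hx x' hx' y hy y' hy' h1 h2 h3
    rcases Finset.mem_insert.1 hB with rfl | hB <;> rcases Finset.mem_insert.1 hC with rfl | hC
    · exact hne rfl
    · have := (memN y).1 hy
      have := hP C hC x' hx'
      have := hP C hC y' hy'
      omega
    · have := (memN x').1 hx'
      have := hP B hB x hx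
      have := hP B hB y hy
      omega
    · exact h.noncrossing B hB C hC hne x hx x' hx' y hy y' hy' h1 h2 h3
  · intro B hB C hC hs hne
    rcases Finset.mem_insert.1 hB with rfl | hB
    · rcases Finset.mem_insert.1 hC with rfl | hC
      · exact absurd rfl hne
      · have hsub : Finset.Ico (t - b) t ⊆ N.filter fun x => ∀ y ∈ C, y < x := by
          intro x hx
          rw [Finset.mem_Ico] at hx
          refine Finset.mem_filter.2 ⟨(memN x).2 (Or.inr hx), fun y hy => ?_⟩
          exact (hP C hC y hy).2.trans_le hx.1
        have := Finset.card_le_card hsub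
        rw [Nat.card_Ico] at this
        omega
    · have := hP B hB s hs
      omega
  · intro B hB C hC hs hlt
    rcases Finset.mem_insert.1 hB with rfl | hB
    · exact absurd ((memN s).2 (by omega)) hs
    · obtain ⟨x, hx, hxC⟩ := hlt
      rcases Finset.mem_insert.1 hC with rfl | hC
      · have := hxC s ((memN s).2 (by omega))
        have := hP B hB x hx
        omega
      -- The first block of the inner family is no longer first; its bound comes from the inner
      -- `first`, whose parameter is `d`.
      · by_cases hs' : s + a ∈ B
        · refine h.first B hB C hC hs' ?_
          rintro rfl
          exact lt_irrefl _ (hxC x hx)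
        · exact h.later B hB C hC hs' ⟨x, hx, hxC⟩

theorem isNestedFamily_codeBlocks {d e s t : ℕ} {L : List (ℕ × ℕ)} (hL : L ∈ codes d e (t - s)) :
    IsNestedFamily d e s t (codeBlocks s t L) := by
  induction L generalizing e s t with
  | nil => exact isNestedFamily_singleton (by have := hL.2; rw [codeSum] at this; omega)
  | cons p L ih =>
    obtain ⟨h1, h2, h3, h4⟩ := codes_cons.1 hL
    refine IsNestedFamily.insert h1 h2 (by omega) (ih ?_)
    rwa [show t - p.2 - (s + p.1) = t - s - p.1 - p.2 by omega]

theorem IsNestedFamily.exists_code {d e s t : ℕ} {P : Finset (Finset ℕ)} (hd : 0 < d) (hst : s < t)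
    (h : IsNestedFamily d e s t P) : ∃ L ∈ codes d e (t - s), codeBlocks s t L = P := by
  induction hl : t - s using Nat.strong_induction_on generalizing e s t P with
  | _ l ih =>
  subst hl
  obtain ⟨B, hB, hsB⟩ := (h.cover s).2 ⟨le_rfl, hst⟩
  have hBI : ∀ x ∈ B, s ≤ x ∧ x < t := fun x hx => h.mem_Ico hB hx
  by_cases hne : (Finset.Ico s t \ B).Nonempty
  · have mem : ∀ x, x ∈ Finset.Ico s t \ B ↔ (s ≤ x ∧ x < t) ∧ x ∉ B := by simp
    obtain ⟨m, hm, hmin⟩ : ∃ m ∈ Finset.Ico s t \ B, ∀ x ∈ Finset.Ico s t \ B, m ≤ x :=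
      ⟨_, Finset.min'_mem _ hne, fun x hx => Finset.min'_le _ x hx⟩
    obtain ⟨M, hM, hmax⟩ : ∃ M ∈ Finset.Ico s t \ B, ∀ x ∈ Finset.Ico s t \ B, x ≤ M :=
      ⟨_, Finset.max'_mem _ hne, fun x hx => Finset.le_max' _ x hx⟩
    have hmM := hmin M hM
    rw [mem] at hm hM
    have hsm : s < m := lt_of_le_of_ne hm.1.1 (by rintro rfl; exact hm.2 hsB)
    have hother : ∀ D ∈ P, D ≠ B → ∀ x ∈ D, m ≤ x ∧ x ≤ M := by
      intro D hD hDB x hx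
      have : x ∈ Finset.Ico s t \ B := (mem x).2
        ⟨h.mem_Ico hD hx, fun hxB => hDB (h.eq_of_mem D hD B hB x hx hxB)⟩
      exact ⟨hmin x this, hmax x this⟩
    obtain ⟨C, hC, hmC⟩ := (h.cover m).2 hm.1
    have hCB : C ≠ B := by rintro rfl; exact hm.2 hmC
    have hlt : ∀ D ∈ P, D ≠ B → D ≠ C → ∀ x ∈ D, m < x := by
      intro D hD hDB hDC x hx
      refine lt_of_le_of_ne (hother D hD hDB x hx).1 ?_
      rintro rfl
      exact hDC (h.eq_of_mem D hD C hC _ hx hmC)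
    have hsC : ∀ D ∈ P, D ≠ B → s ∉ D := fun D hD hDB hs =>
      hDB (h.eq_of_mem D hD B hB s hs hsB)
    -- Otherwise the block of `M` starts after `C`, and `0 < d` gives an element of `C` above the
    -- maximum `M`.
    have hMC : M ∈ C := by
      obtain ⟨D, hD, hMD⟩ := (h.cover M).2 hM.1
      have hDB : D ≠ B := by rintro rfl; exact hM.2 hMD
      by_cases hDC : D = C
      · rwa [← hDC]
      · have h1 := h.later C hC D hD (hsC C hC hCB) ⟨m, hmC, hlt D hD hDB hDC⟩
        obtain ⟨x, hx⟩ := Finset.card_pos.1 (hd.trans_le h1)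
        rw [Finset.mem_filter] at hx
        exact absurd (hx.2 M hMD) (not_lt.2 (hother C hC hCB x hx.1).2)
    have hBeq : B = Finset.Ico s (s + (m - s)) ∪ Finset.Ico (t - (t - (M + 1))) t := by
      ext x
      rw [Finset.mem_union, Finset.mem_Ico, Finset.mem_Ico]
      constructor
      · intro hx
        have h1 := hBI x hx
        by_contra hcon
        have h2 : x ≠ m := by rintro rfl; exact hm.2 hx
        have h3 : x ≠ M := by rintro rfl; exact hM.2 hx
        -- An element `x` of `B` between `m` and `M` would give the crossing `s < m < x < M`.
        exact h.noncrossing B hB C hC hCB.symm s hsB m hmC x hx M hMC hsm (by omega) (by omega)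
      · intro hx
        by_contra hcon
        have h1 : x ∈ Finset.Ico s t \ B := (mem x).2 ⟨by omega, hcon⟩
        have h2 := hmin x h1
        have h3 := hmax x h1
        omega
    have heb : e ≤ t - (M + 1) := by
      refine (h.first B hB C hC hsB hCB.symm).trans ?_
      rw [← Nat.card_Ico]
      refine Finset.card_le_card fun x hx => ?_
      rw [Finset.mem_filter] at hx
      exact Finset.mem_Ico.2 ⟨hx.2 M hMC, (hBI x hx.1).2⟩
    have hP : IsNestedFamily d d m (M + 1) (P.erase B) := by
      constructor
      · exact fun D hD => h.nonempty D (Finset.mem_of_mem_erase hD)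
      · exact fun D hD E hE =>
          h.eq_of_mem D (Finset.mem_of_mem_erase hD) E (Finset.mem_of_mem_erase hE)
      · intro x
        constructor
        · rintro ⟨D, hD, hx⟩
          have := hother D (Finset.mem_of_mem_erase hD) (Finset.ne_of_mem_erase hD) x hx
          omega
        · intro hx
          obtain ⟨D, hD, hxD⟩ := (h.cover x).2 (by omega)
          refine ⟨D, Finset.mem_erase.2 ⟨?_, hD⟩, hxD⟩
          rintro rfl
          rw [hBeq, Finset.mem_union, Finset.mem_Ico, Finset.mem_Ico] at hxD
          omega
      · exact fun D hD E hE =>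
          h.noncrossing D (Finset.mem_of_mem_erase hD) E (Finset.mem_of_mem_erase hE)
      -- The block containing `m` is `C`, and all remaining blocks start later, so the old `later`
      -- becomes the new `first`.
      · intro D hD E hE hmD hDE
        obtain ⟨hDB, hD⟩ := Finset.mem_erase.1 hD
        obtain ⟨hEB, hE⟩ := Finset.mem_erase.1 hE
        have hDC := h.eq_of_mem D hD C hC m hmD hmC
        exact h.later D hD E hE (hsC D hD hDB)
          ⟨m, hmD, hlt E hE hEB (by rw [← hDC]; exact hDE.symm)⟩
      · intro D hD E hE _
        obtain ⟨hDB, hD⟩ := Finset.mem_erase.1 hD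
        exact h.later D hD E (Finset.mem_of_mem_erase hE) (hsC D hD hDB)
    obtain ⟨L, hL, hLP⟩ := ih (M + 1 - m) (by omega) (by omega) hP rfl
    refine ⟨(m - s, t - (M + 1)) :: L, codes_cons.2 ⟨?_, heb, ?_, ?_⟩, ?_⟩
    · dsimp only; omega
    · dsimp only; omega
    · dsimp only
      rwa [show t - s - (m - s) - (t - (M + 1)) = M + 1 - m by omega]
    · rw [codeBlocks]
      dsimp only
      rw [← hBeq, show s + (m - s) = m by omega, show t - (t - (M + 1)) = M + 1 by omega, hLP,
        Finset.insert_erase hB]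
  · have hBeq : B = Finset.Ico s t := by
      refine Finset.Subset.antisymm (fun x hx => Finset.mem_Ico.2 (hBI x hx)) ?_
      rwa [Finset.not_nonempty_iff_eq_empty, Finset.sdiff_eq_empty_iff_subset] at hne
    refine ⟨[], ⟨trivial, by rw [codeSum]; omega⟩, ?_⟩
    rw [codeBlocks, ← hBeq]
    ext D
    rw [Finset.mem_singleton]
    refine ⟨by rintro rfl; exact hB, fun hD => ?_⟩
    obtain ⟨x, hx⟩ := h.nonempty D hD
    exact h.eq_of_mem D hD B hB x hx (hBeq ▸ Finset.mem_Ico.2 (h.mem_Ico hD hx))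

theorem le_of_Ico_union_Ico_eq {s t a b a' b' : ℕ} (hab : s + a < t - b)
    (h : Finset.Ico s (s + a') ∪ Finset.Ico (t - b') t =
      Finset.Ico s (s + a) ∪ Finset.Ico (t - b) t) : a' ≤ a ∧ b' ≤ b := by
  simp only [Finset.ext_iff, Finset.mem_union, Finset.mem_Ico] at h
  constructor
  · by_contra hlt
    have := (h (s + a)).1 (by omega)
    omega
  · by_contra hlt
    have := (h (t - b - 1)).1 (by omega)
    omega

/-- The outermost block is recognised as the one containing `s`; its two end segments give the first
pair, and erasing it leaves the blocks of the tail. -/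
theorem codeBlocks_injOn (d e s t : ℕ) : Set.InjOn (codeBlocks s t) (codes d e (t - s)) := by
  intro L hL L' hL' heq
  induction L generalizing e s t L' with
  | nil =>
    rcases L' with - | ⟨q, L'⟩
    · rfl
    · exfalso
      obtain ⟨k1, k2, k3, k4⟩ := codes_cons.1 hL'
      have h1 : Finset.Ico s (s + q.1) ∪ Finset.Ico (t - q.2) t ∈ codeBlocks s t [] := by
        rw [heq, codeBlocks]
        exact Finset.mem_insert_self _ _
      rw [codeBlocks, Finset.mem_singleton, Finset.ext_iff] at h1
      have := h1 (s + q.1)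
      simp only [Finset.mem_union, Finset.mem_Ico] at this
      omega
  | cons p L ih =>
    obtain ⟨h1, h2, h3, h4⟩ := codes_cons.1 hL
    rcases L' with - | ⟨q, L'⟩
    · exfalso
      have h1 : Finset.Ico s (s + p.1) ∪ Finset.Ico (t - p.2) t ∈ codeBlocks s t [] := by
        rw [← heq, codeBlocks]
        exact Finset.mem_insert_self _ _
      rw [codeBlocks, Finset.mem_singleton, Finset.ext_iff] at h1
      have := h1 (s + p.1)
      simp only [Finset.mem_union, Finset.mem_Ico] at this
      omega
    · obtain ⟨k1, k2, k3, k4⟩ := codes_cons.1 hL'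
      have hfam := isNestedFamily_codeBlocks hL
      rw [show t - s - p.1 - p.2 = t - p.2 - (s + p.1) by omega] at h4
      rw [show t - s - q.1 - q.2 = t - q.2 - (s + q.1) by omega] at k4
      have hN := hfam.eq_of_mem _ (by rw [codeBlocks]; exact Finset.mem_insert_self _ _)
        (Finset.Ico s (s + q.1) ∪ Finset.Ico (t - q.2) t)
        (by rw [heq, codeBlocks]; exact Finset.mem_insert_self _ _) s
        (by simp; omega) (by simp; omega)
      have notMem : ∀ {a b : ℕ} {M : List (ℕ × ℕ)}, M ∈ codes d d (t - b - (s + a)) → 1 ≤ a →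
          Finset.Ico s (s + a) ∪ Finset.Ico (t - b) t ∉ codeBlocks (s + a) (t - b) M := by
        intro a b M hM ha hmem
        have := (isNestedFamily_codeBlocks hM).mem_Ico hmem (x := s) (by simp; omega)
        omega
      have h3' : s + p.1 < t - p.2 := by omega
      have k3' : s + q.1 < t - q.2 := by omega
      have hpq : p = q := by
        obtain ⟨e3, e4⟩ := le_of_Ico_union_Ico_eq h3' hN.symm
        obtain ⟨e1, e2⟩ := le_of_Ico_union_Ico_eq k3' hN
        exact Prod.ext (le_antisymm e1 e3) (le_antisymm e2 e4)
      subst hpq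
      rw [codeBlocks, codeBlocks] at heq
      have := congrArg
        (Finset.erase · (Finset.Ico s (s + p.1) ∪ Finset.Ico (t - p.2) t)) heq
      rw [Finset.erase_insert (notMem h4 h1), Finset.erase_insert (notMem k4 k1)] at this
      rw [ih _ _ _ h4 k4 this]

/-! ### Restricted non-crossing partitions as nested families. -/

/-- Some arc `{u, v}` of `B` passes over `a'`, with `v ≤ b < b'`. Then some arc `{u', v'}` of `C`
passes over `v`, with `a' ≤ u'`, and these two arcs cross. -/
theorem IsNonCrossing.false_of_cross {s : Finset ℕ} {π : Finpartition s} (hπ : IsNonCrossing π)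
    {B C : Finset ℕ} (hB : B ∈ π.parts) (hC : C ∈ π.parts) (hne : B ≠ C) {a a' b b' : ℕ}
    (ha : a ∈ B) (ha' : a' ∈ C) (hb : b ∈ B) (hb' : b' ∈ C) (h1 : a < a') (h2 : a' < b)
    (h3 : b < b') : False := by
  have arc : ∀ {D : Finset ℕ}, D ∈ π.parts → ∀ {x y z : ℕ}, x ∈ D → y ∈ D → z ∉ D → x < z →
      z < y → ∃ u v, IsArc π u v ∧ x ≤ u ∧ u < z ∧ z < v ∧ v ≤ y ∧ u ∈ D ∧ v ∈ D := by
    intro D hD x y z hx hy hz hxz hzy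
    have hl : (D.filter (· < z)).Nonempty := ⟨x, by simp [hx, hxz]⟩
    have hr : (D.filter (z < ·)).Nonempty := ⟨y, by simp [hy, hzy]⟩
    obtain ⟨u, hu, hu'⟩ : ∃ u ∈ D.filter (· < z), ∀ w ∈ D.filter (· < z), w ≤ u :=
      ⟨_, Finset.max'_mem _ hl, fun w hw => Finset.le_max' _ w hw⟩
    obtain ⟨v, hv, hv'⟩ : ∃ v ∈ D.filter (z < ·), ∀ w ∈ D.filter (z < ·), v ≤ w :=
      ⟨_, Finset.min'_mem _ hr, fun w hw => Finset.min'_le _ w hw⟩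
    simp only [Finset.mem_filter] at hu hv hu' hv'
    refine ⟨u, v, ⟨D, hD, hu.1, hv.1, hu.2.trans hv.2, fun c hc hcon => ?_⟩, hu' x ⟨hx, hxz⟩,
      hu.2, hv.2, hv' y ⟨hy, hzy⟩, hu.1, hv.1⟩
    rcases lt_trichotomy c z with h | h | h
    · have := hu' c ⟨hc, h⟩
      omega
    · exact hz (h ▸ hc)
    · have := hv' c ⟨hc, h⟩
      omega
  have disj : ∀ x, x ∈ B → x ∉ C := fun x hxB hxC =>
    hne (π.eq_of_mem_parts hB hC hxB hxC)
  obtain ⟨u, v, huv, -, huz, hzv, hvb, hu, hv⟩ :=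
    arc hB ha hb (fun h => disj a' h ha') h1 h2
  obtain ⟨u', v', huv', hau', hu'z, hzv', -, -, -⟩ :=
    arc hC ha' hb' (disj v hv) hzv (by omega)
  exact hπ u v u' v' huv huv' ⟨by omega, hu'z, hzv'⟩

theorem min_lt_min_iff {B C : Finset ℕ} (hB : B.Nonempty) (hC : C.Nonempty) :
    B.min < C.min ↔ ∃ x ∈ B, ∀ y ∈ C, x < y := by
  constructor
  · intro h
    refine ⟨B.min' hB, B.min'_mem hB, fun y hy => ?_⟩
    rw [← Finset.coe_min' hB] at h
    exact WithTop.coe_lt_coe.1 (h.trans_le (Finset.min_le hy))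
  · rintro ⟨x, hx, h⟩
    rw [← Finset.coe_min' hC]
    exact (Finset.min_le hx).trans_lt (WithTop.coe_lt_coe.2 (h _ (C.min'_mem hC)))

theorem max_lt_coe_iff {C : Finset ℕ} (hC : C.Nonempty) {x : ℕ} :
    C.max < (x : WithBot ℕ) ↔ ∀ y ∈ C, y < x := by
  rw [← Finset.coe_max' hC]
  exact WithBot.coe_lt_coe.trans (Finset.max'_lt_iff C hC)

/-- The definition compares only neighbouring blocks, a nested family all pairs. Let `E` follow `B`,
and let `C` come later. Inductively `E` has an element above all of `C`, as `0 < d`; the `d`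
elements of `B` above `E` are then above `C` too. The first block is unconstrained, which is `e =
0`. -/
theorem isNestedFamily_parts_iff {d n : ℕ} (hd : 0 < d) (π : Finpartition (Finset.Icc 1 n)) :
    IsNestedFamily d 0 1 (n + 1) π.parts ↔ π ∈ restrictedNC d n := by
  have hfilter : ∀ B : Finset ℕ, ∀ C ∈ π.parts,
      (B.filter fun x : ℕ => C.max < (x : WithBot ℕ)) = B.filter fun x => ∀ y ∈ C, y < x :=
    fun B C hC => Finset.filter_congr fun x _ => max_lt_coe_iff (π.nonempty_of_mem_parts hC)
  have hcover : ∀ x, (∃ B ∈ π.parts, x ∈ B) ↔ 1 ≤ x ∧ x < n + 1 := by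
    intro x
    refine (show _ ↔ x ∈ Finset.Icc 1 n from ⟨?_, π.exists_mem⟩).trans ?_
    · rintro ⟨B, hB, hx⟩
      exact π.le hB hx
    · rw [Finset.mem_Icc]
      omega
  constructor
  · intro h
    refine ⟨fun a b a' b' ⟨B, hB, ha, hb, hab, hB'⟩ ⟨C, hC, ha', hb', hab', hC'⟩ ⟨h1, h2, h3⟩ => ?_,
      fun B C hBC ⟨A, hA, hAB⟩ => ?_⟩
    · refine h.noncrossing B hB C hC ?_ a ha a' ha' b hb b' hb' h1 h2 h3
      rintro rfl
      exact hB' a' ha' ⟨h1, h2⟩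
    · rw [hfilter B C hBC.2.1]
      refine h.later B hBC.1 C hBC.2.1 (fun hB1 => ?_) ((min_lt_min_iff
        (π.nonempty_of_mem_parts hBC.1) (π.nonempty_of_mem_parts hBC.2.1)).1 hBC.2.2.1)
      obtain ⟨x, hx, hxB⟩ := (min_lt_min_iff (π.nonempty_of_mem_parts hA)
        (π.nonempty_of_mem_parts hBC.1)).1 hAB
      have := hxB 1 hB1
      have := h.mem_Ico hA hx
      omega
  · rintro ⟨hnc, hcond⟩
    refine ⟨fun B hB => π.nonempty_of_mem_parts hB,
      fun B hB C hC x hxB hxC => π.eq_of_mem_parts hB hC hxB hxC, hcover,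
      fun B hB C hC hne a ha a' ha' b hb b' hb' h1 h2 h3 =>
        hnc.false_of_cross hB hC hne ha ha' hb hb' h1 h2 h3, fun _ _ _ _ _ _ => Nat.zero_le _, ?_⟩
    -- Here `x` is the minimum of `B`; since minima grow along the list of blocks, `n - x`
    -- decreases.
    have key : ∀ C ∈ π.parts, ∀ m : ℕ, ∀ B ∈ π.parts, 1 ∉ B → ∀ x ∈ B, n - x = m →
        (∀ y ∈ B, x ≤ y) → (∀ y ∈ C, x < y) →
        d ≤ (B.filter fun x => ∀ y ∈ C, y < x).card := by
      intro C hC m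
      induction m using Nat.strong_induction_on with
      | _ m ih =>
      intro B hB hB1 x hx hm hxB hxC
      have hxn := (hcover x).1 ⟨B, hB, hx⟩
      obtain ⟨A, hA, hA1⟩ := (hcover 1).2 ⟨le_rfl, by omega⟩
      have hAB : A.min < B.min := (min_lt_min_iff (π.nonempty_of_mem_parts hA)
        (π.nonempty_of_mem_parts hB)).2 ⟨1, hA1, fun y hy => lt_of_le_of_ne
          ((hcover y).1 ⟨B, hB, hy⟩).1 (by rintro rfl; exact hB1 hy)⟩
      obtain ⟨E, hE, hEmin⟩ := Finset.exists_min_image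
        (π.parts.filter fun E => B.min < E.min) Finset.min ⟨C, Finset.mem_filter.2 ⟨hC,
          (min_lt_min_iff ⟨x, hx⟩ (π.nonempty_of_mem_parts hC)).2 ⟨x, hx, hxC⟩⟩⟩
      obtain ⟨hE, hBE⟩ := Finset.mem_filter.1 hE
      have hnext : IsNextBlock π B E := ⟨hB, hE, hBE, fun F hF hcon =>
        not_lt.2 (hEmin F (Finset.mem_filter.2 ⟨hF, hcon.1⟩)) hcon.2⟩
      have h1 := hcond B E hnext ⟨A, hA, hAB⟩
      rw [hfilter B E hE] at h1
      by_cases hEC : E = C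
      · rwa [← hEC]
      · obtain ⟨z, hz, hzE⟩ : ∃ z ∈ E, ∀ w ∈ E, z ≤ w :=
          ⟨_, E.min'_mem (π.nonempty_of_mem_parts hE), fun w hw => E.min'_le w hw⟩
        obtain ⟨u, hu, huE⟩ := (min_lt_min_iff ⟨x, hx⟩ ⟨z, hz⟩).1 hBE
        have hxz : x < z := (hxB u hu).trans_lt (huE z hz)
        have hzn := (hcover z).1 ⟨E, hE, hz⟩
        have hCx := (min_lt_min_iff ⟨x, hx⟩ (π.nonempty_of_mem_parts hC)).2 ⟨x, hx, hxC⟩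
        have hEC' := hEmin C (Finset.mem_filter.2 ⟨hC, hCx⟩)
        have hzC : ∀ y ∈ C, z < y := by
          intro y hy
          have h2 : z ≤ y := by
            have h3 : (z : WithTop ℕ) ≤ E.min := Finset.le_min fun w hw =>
              WithTop.coe_le_coe.2 (hzE w hw)
            exact WithTop.coe_le_coe.1 ((h3.trans hEC').trans (Finset.min_le hy))
          refine lt_of_le_of_ne h2 ?_
          rintro rfl
          exact hEC (π.eq_of_mem_parts hE hC hz hy)
        have h2 := ih (n - z) (by omega) E hE (fun h => by have := hzE 1 h; omega) z hz rfl hzE hzC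
        obtain ⟨v, hv⟩ := Finset.card_pos.1 (hd.trans_le h2)
        rw [Finset.mem_filter] at hv
        refine h1.trans (Finset.card_le_card fun w hw => ?_)
        rw [Finset.mem_filter] at hw ⊢
        exact ⟨hw.1, fun y hy => (hv.2 y hy).trans (hw.2 v hv.1)⟩
    rintro B hB C hC hB1 ⟨x, hx, hxC⟩
    have hBn := π.nonempty_of_mem_parts hB
    exact key C hC _ B hB hB1 _ (B.min'_mem hBn) rfl (fun y hy => B.min'_le y hy)
      fun y hy => (B.min'_le x hx).trans_lt (hxC y hy)

theorem IsNestedFamily.exists_finpartition {d e n : ℕ} {P : Finset (Finset ℕ)}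
    (h : IsNestedFamily d e 1 (n + 1) P) :
    ∃ π : Finpartition (Finset.Icc 1 n), π.parts = P := by
  refine ⟨⟨P, ?_, ?_, fun h0 => Finset.not_nonempty_empty (h.nonempty _ h0)⟩, rfl⟩
  · rw [Finset.supIndep_iff_pairwiseDisjoint]
    intro B hB C hC hne
    rw [Function.onFun, id, id, Finset.disjoint_left]
    exact fun x hxB hxC => hne (h.eq_of_mem B hB C hC x hxB hxC)
  · ext x
    rw [Finset.mem_sup, Finset.mem_Icc]
    exact (h.cover x).trans (by omega)

theorem parts_image_restrictedNC {d n : ℕ} (hd : 0 < d) (hn : 0 < n) :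
    Finpartition.parts '' restrictedNC d n = codeBlocks 1 (n + 1) '' codes d 0 n := by
  ext P
  constructor
  · rintro ⟨π, hπ, rfl⟩
    exact ((isNestedFamily_parts_iff hd π).2 hπ).exists_code hd (by omega)
  · rintro ⟨L, hL, rfl⟩
    have h := isNestedFamily_codeBlocks (s := 1) (t := n + 1) hL
    obtain ⟨π, hπ⟩ := h.exists_finpartition
    exact ⟨π, (isNestedFamily_parts_iff hd π).1 (hπ ▸ h), hπ⟩

/-! ### The bijections and the case `n = 0`. -/

theorem nonempty_equiv_of_image_eq {α β γ : Type*} {f : α → γ} {g : β → γ} {s : Set α}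
    {t : Set β} (hf : Set.InjOn f s) (hg : Set.InjOn g t) (h : f '' s = g '' t) :
    Nonempty (s ≃ t) :=
  ⟨(Equiv.Set.imageOfInjOn f s hf).trans
    ((Equiv.setCongr h).trans (Equiv.Set.imageOfInjOn g t hg).symm)⟩

theorem toList_injective : Function.Injective DyckWord.toList :=
  fun _ _ h => DyckWord.ext h

theorem parts_injective (n : ℕ) :
    Function.Injective (Finpartition.parts : Finpartition (Finset.Icc 1 n) → _) :=
  fun _ _ h => Finpartition.ext h

theorem nonempty_restrictedDyckPaths_equiv_codes {d n : ℕ} (hn : 0 < n) :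
    Nonempty (restrictedDyckPaths d n ≃ codes d 0 n) :=
  nonempty_equiv_of_image_eq toList_injective.injOn (codeWord_injOn d 0 0 n)
    (toList_image_restrictedDyckPaths hn)

theorem nonempty_restrictedNC_equiv_codes {d n : ℕ} (hd : 0 < d) (hn : 0 < n) :
    Nonempty (restrictedNC d n ≃ codes d 0 n) :=
  nonempty_equiv_of_image_eq (parts_injective n).injOn (codeBlocks_injOn d 0 1 (n + 1))
    (parts_image_restrictedNC hd hn)

theorem restrictedDyckPaths_zero (d : ℤ) : restrictedDyckPaths d 0 = {0} := by
  ext p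
  rw [Set.mem_singleton_iff]
  constructor
  · rintro ⟨h, -⟩
    refine DyckWord.ext (List.length_eq_zero_iff.1 ?_)
    rw [← p.two_mul_semilength_eq_length, h]
  · rintro rfl
    exact ⟨rfl, List.isChain_nil⟩

theorem restrictedNC_zero (d : ℕ) : restrictedNC d 0 = {⊥} := by
  have hempty : ∀ π : Finpartition (Finset.Icc 1 0), π.parts = ∅ := fun π =>
    π.parts_eq_empty_iff.2 rfl
  ext π
  rw [Set.mem_singleton_iff]
  constructor
  · intro _
    exact Finpartition.ext ((hempty _).trans (hempty _).symm)
  · rintro rfl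
    refine ⟨?_, ?_⟩
    · rintro a b a' b' ⟨B, hB, -⟩
      simp [hempty] at hB
    · rintro B C ⟨hB, -⟩
      simp [hempty] at hB

/-- For `2 ≤ n + d` no truncation occurs in `(n + d - 2) / d`, and in the range of summation
`n - (d - 1) * (k - 1)` is a non-negative integer. -/
theorem mainTheorem3 (d n : ℕ) (hd : 0 < d) :
    Nonempty (restrictedDyckPaths (d : ℤ) n ≃ restrictedNC d n) ∧
    (2 ≤ n + d →
      (restrictedNC d n).ncard =
        ∑ k ∈ Finset.range ((n + d - 2) / d + 1),
          ((n : ℤ) - ((d : ℤ) - 1) * ((k : ℤ) - 1)).toNat.choose (2 * k)) := by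
  rcases Nat.eq_zero_or_pos n with rfl | hn
  · rw [restrictedDyckPaths_zero, restrictedNC_zero]
    refine ⟨⟨Equiv.ofUnique _ _⟩, fun h => ?_⟩
    -- Here `2 ≤ d`, so the quotient `(d - 2) / d` is 0 and only the term `k = 0`, equal to 1,
    -- remains.
    rw [Set.ncard_singleton, Nat.div_eq_of_lt (by omega)]
    simp
  · obtain ⟨f⟩ := nonempty_restrictedDyckPaths_equiv_codes (d := d) hn
    obtain ⟨g⟩ := nonempty_restrictedNC_equiv_codes hd hn
    refine ⟨⟨f.trans g.symm⟩, fun _ => ?_⟩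
    rw [← ncard_codes hd hn]
    exact Nat.card_congr g
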